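/- For $n \ge 0$ let $A_3(n)$ denote the number of ordered pairs $(\lambda_1,\lambda_2)$ of partitions (either may be empty) with $|\lambda_1|+|\lambda_2| = n$ such that $\lambda_1$ and $\lambda_2$ are both $3$-cores, that is, none of their hook numbers is a multiple of $3$. Let $p$ be an odd prime and let $j \ge 1$ be an integer. Then there is a positive integer $k_0$, namely $k_0 = p^j(p-1)/2$, such that for all integers $n, \alpha \ge 0$ the number $\bigl(2^{2k_0(\alpha+1)-1}-2\bigr)/3$ is an integer and $$A_3\Bigl(4^{k_0(\alpha+1)}\, n + \frac{2^{2k_0(\alpha+1)-1}-2}{3}\Bigr) \equiv 0 \pmod{p^j}.$$ -/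

import Mathlib

/-- The hook number of the cell `(i, j)` of a Young diagram: the cells strictly to its right in
row `i`, the cells strictly below it in column `j`, and the cell itself. It is meant for cells of
the diagram, where no subtraction truncates. -/
def YoungDiagram.hookNumber (μ : YoungDiagram) (i j : ℕ) : ℕ :=
  (μ.rowLen i - (j + 1)) + (μ.colLen j - (i + 1)) + 1

/-- The Young diagram of a partition: its rows are the parts in nonincreasing order. -/
def Nat.Partition.youngDiagram {n : ℕ} (l : n.Partition) : YoungDiagram :=
  YoungDiagram.ofRowLens (l.parts.sort (· ≥ ·)) (l.parts.pairwise_sort (· ≥ ·)).sortedGE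

/-- A partition is a `t`-core if none of its hook numbers is a multiple of `t`. -/
def Nat.Partition.IsCore {n : ℕ} (t : ℕ) (l : n.Partition) : Prop :=
  ∀ c ∈ l.youngDiagram.cells, ¬ t ∣ l.youngDiagram.hookNumber c.1 c.2

instance Nat.Partition.decidableIsCore {n : ℕ} (t : ℕ) (l : n.Partition) :
    Decidable (l.IsCore t) :=
  inferInstanceAs (Decidable (∀ c ∈ l.youngDiagram.cells,
    ¬ t ∣ l.youngDiagram.hookNumber c.1 c.2))

/-- The `t`-core partitions of `n`. -/
def corePartitions (t n : ℕ) : Finset n.Partition :=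
  Finset.univ.filter fun l => l.IsCore t

/-- The partition pairs of `n` with `t`-cores: ordered pairs of `t`-core partitions, of `k` and of
`m`, where `k + m = n`. -/
def corePartitionPairs (t n : ℕ) : Finset (Σ s : ℕ × ℕ, s.1.Partition × s.2.Partition) :=
  (Finset.HasAntidiagonal.antidiagonal n).sigma fun s => corePartitions t s.1 ×ˢ corePartitions t s.2

/-- The number of partition pairs of `n` with 3-cores. -/
def A₃ (n : ℕ) : ℕ := (corePartitionPairs 3 n).card

/-! First column hook lengths (beads) turn a 3-core of `n` into a pair `(a, b)` of naturals with `n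
= a² + b² + b - ab`, hence into an Eisenstein integer of norm `3n + 1` up to the six units. Let
`R(m)` count pairs of Eisenstein integers with norms summing to `m`. Norms are 0 or 1 mod 3, so
`R(3n + 2) = 36 A₃(n)` (`card_eisPairReps`).

Reduction mod 2, onto the field with four elements, gives `R(4m) + 2R(m) = 3R(2m)`, and so `R(2^t m)
= (2^(t+1) - 1) R(m)` for odd `m` (`card_eisPairReps_two_pow_mul`). The argument `N` in the theorem
satisfies `3N + 2 = 2^(2k₀(α+1)-1) (6n + 1)`, and `2k₀ = φ(p^(j+1))`, so Euler's theorem makes the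
factor divisible by `p^(j+1)`. The spare power of `p`, together with `3 ∣ R(6n + 1)`, pays for the
36 when `p = 3`. -/

/-! ### Sums of two Eisenstein norms -/

/-- The norm form `x² + xy + y²` of the Eisenstein integers. -/
def eisNorm (v : ℤ × ℤ) : ℤ := v.1 ^ 2 + v.1 * v.2 + v.2 ^ 2

/-- Multiplication by a primitive sixth root of unity on the Eisenstein integers. -/
def eisRot : ℤ × ℤ ≃ ℤ × ℤ where
  toFun v := (-v.2, v.1 + v.2)
  invFun v := (v.1 + v.2, -v.1)
  left_inv v := by ext <;> simp
  right_inv v := by ext <;> simp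

@[simp] theorem eisRot_apply (x y : ℤ) : eisRot (x, y) = (-y, x + y) := rfl

@[simp] theorem eisNorm_eisRot (v : ℤ × ℤ) : eisNorm (eisRot v) = eisNorm v := by
  obtain ⟨x, y⟩ := v
  simp only [eisNorm, eisRot_apply]
  ring

theorem eisNorm_nonneg (v : ℤ × ℤ) : 0 ≤ eisNorm v := by
  simp only [eisNorm]
  nlinarith [sq_nonneg (v.1 + v.2), sq_nonneg v.1, sq_nonneg v.2]

theorem mem_Icc_of_eisNorm_le {v : ℤ × ℤ} {m : ℤ} (h : eisNorm v ≤ m) :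
    v ∈ Finset.Icc (-2 * m) (2 * m) ×ˢ Finset.Icc (-2 * m) (2 * m) := by
  obtain ⟨x, y⟩ := v
  simp only [eisNorm] at h
  have key : ∀ a b : ℤ, a ^ 2 + a * b + b ^ 2 ≤ m → -2 * m ≤ a ∧ a ≤ 2 * m := by
    intro a b hab
    have h1 : 3 * a ^ 2 ≤ 4 * m := by nlinarith [sq_nonneg (a + 2 * b)]
    have h2 : a ≤ a ^ 2 := by nlinarith [Int.le_self_sq a]
    have h3 : -a ≤ a ^ 2 := by nlinarith [Int.le_self_sq (-a)]
    have h4 := sq_nonneg a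
    constructor <;> omega
  simp only [Finset.mem_product, Finset.mem_Icc]
  exact ⟨key x y h, key y x (by linarith)⟩

/-- The Eisenstein integers of norm `m`. -/
noncomputable def eisReps (m : ℤ) : Finset (ℤ × ℤ) :=
  (Finset.Icc (-2 * m) (2 * m) ×ˢ Finset.Icc (-2 * m) (2 * m)).filter fun v => eisNorm v = m

@[simp] theorem mem_eisReps {m : ℤ} {v : ℤ × ℤ} : v ∈ eisReps m ↔ eisNorm v = m := by
  rw [eisReps, Finset.mem_filter, and_iff_right_iff_imp]
  exact fun h => mem_Icc_of_eisNorm_le h.le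

/-- The pairs of Eisenstein integers whose norms sum to `m`. -/
noncomputable def eisPairReps (m : ℤ) : Finset ((ℤ × ℤ) × (ℤ × ℤ)) :=
  ((Finset.Icc (-2 * m) (2 * m) ×ˢ Finset.Icc (-2 * m) (2 * m)) ×ˢ
    (Finset.Icc (-2 * m) (2 * m) ×ˢ Finset.Icc (-2 * m) (2 * m))).filter
      fun v => eisNorm v.1 + eisNorm v.2 = m

@[simp] theorem mem_eisPairReps {m : ℤ} {v : (ℤ × ℤ) × (ℤ × ℤ)} :
    v ∈ eisPairReps m ↔ eisNorm v.1 + eisNorm v.2 = m := by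
  rw [eisPairReps, Finset.mem_filter, and_iff_right_iff_imp]
  intro h
  have h1 := eisNorm_nonneg v.1
  have h2 := eisNorm_nonneg v.2
  exact Finset.mem_product.2 ⟨mem_Icc_of_eisNorm_le (by linarith),
    mem_Icc_of_eisNorm_le (by linarith)⟩

/-- Congruence modulo `2` of Eisenstein integers. -/
def EisCongTwo (v w : ℤ × ℤ) : Prop := Even (v.1 + w.1) ∧ Even (v.2 + w.2)

instance (v w : ℤ × ℤ) : Decidable (EisCongTwo v w) := by
  unfold EisCongTwo; infer_instance

/-- Parallelogram law: `(v, w) ↦ (v + w, v - w)` doubles the sum of norms, and its image is the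
pairs congruent mod 2. -/
theorem card_filter_congTwo (m : ℤ) :
    ((eisPairReps (2 * m)).filter fun v => EisCongTwo v.1 v.2).card = (eisPairReps m).card := by
  symm
  refine Finset.card_nbij' (fun v => (v.1 + v.2, v.1 - v.2))
    (fun v => (((v.1.1 + v.2.1) / 2, (v.1.2 + v.2.2) / 2),
      ((v.1.1 - v.2.1) / 2, (v.1.2 - v.2.2) / 2))) ?_ ?_ ?_ ?_
  · rintro ⟨⟨x, y⟩, ⟨z, w⟩⟩ h
    simp only [Finset.mem_coe, mem_eisPairReps, Finset.mem_filter] at h ⊢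
    simp only [eisNorm, EisCongTwo,
      Prod.fst_add, Prod.snd_add, Prod.fst_sub, Prod.snd_sub] at h ⊢
    refine ⟨by linarith, ⟨x, by ring⟩, ⟨y, by ring⟩⟩
  · rintro ⟨⟨x, y⟩, ⟨z, w⟩⟩ h
    simp only [Finset.mem_coe, mem_eisPairReps, Finset.mem_filter] at h ⊢
    simp only [eisNorm, EisCongTwo] at h ⊢
    obtain ⟨h, ⟨a, ha⟩, ⟨b, hb⟩⟩ := h
    obtain rfl : x = a + a - z := by linarith
    obtain rfl : y = b + b - w := by linarith
    rw [show (a + a - z + z) / 2 = a by omega, show (b + b - w + w) / 2 = b by omega,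
      show (a + a - z - z) / 2 = a - z by omega, show (b + b - w - w) / 2 = b - w by omega]
    linarith
  · rintro ⟨⟨x, y⟩, ⟨z, w⟩⟩ _
    simp only [Prod.fst_add, Prod.snd_add, Prod.fst_sub, Prod.snd_sub, Prod.mk.injEq]
    omega
  · rintro ⟨⟨x, y⟩, ⟨z, w⟩⟩ h
    simp only [Finset.mem_coe, Finset.mem_filter] at h
    simp only [EisCongTwo, Int.even_iff] at h
    simp only [Prod.mk_add_mk, Prod.mk_sub_mk, Prod.mk.injEq]
    omega

theorem card_filter_congTwo_rot (m : ℤ) (e : ℤ × ℤ ≃ ℤ × ℤ)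
    (he : ∀ v, eisNorm (e v) = eisNorm v) :
    ((eisPairReps (2 * m)).filter fun v => EisCongTwo v.1 (e v.2)).card =
      (eisPairReps m).card := by
  rw [← card_filter_congTwo]
  refine Finset.card_equiv ((Equiv.refl _).prodCongr e) fun v => ?_
  simp [he]

/-- A norm is even only for multiples of 2. So in a pair with even norm sum, either both entries
vanish mod 2 or both are nonzero in the field of four elements. In the second case exactly one of
the three rotated congruences holds; in the first, all three do, whence the correction term. -/
theorem card_eisPairReps_two_mul_add (m : ℤ) :
    (eisPairReps (2 * m)).card +
      2 * ((eisPairReps (2 * m)).filter fun v => EisCongTwo v.1 0 ∧ EisCongTwo v.2 0).card =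
      3 * (eisPairReps m).card := by
  have h0 := card_filter_congTwo m
  have h1 := card_filter_congTwo_rot m eisRot (by simp)
  have h2 := card_filter_congTwo_rot m (eisRot.trans eisRot) (by simp)
  have : 3 * (eisPairReps m).card = (eisPairReps m).card + (eisPairReps m).card
    + (eisPairReps m).card := by ring
  rw [this]
  nth_rw 1 [← h0]
  nth_rw 1 [← h1]
  rw [← h2]
  simp only [Finset.card_filter, Finset.mul_sum]
  rw [Finset.card_eq_sum_ones, ← Finset.sum_add_distrib, ← Finset.sum_add_distrib,
    ← Finset.sum_add_distrib]
  refine Finset.sum_congr rfl fun v hv => ?_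
  obtain ⟨⟨x, y⟩, ⟨z, w⟩⟩ := v
  have hev : Even (eisNorm (x, y) + eisNorm (z, w)) := ⟨m, by rw [mem_eisPairReps.1 hv]; ring⟩
  simp only [eisNorm, EisCongTwo, eisRot_apply, Equiv.trans_apply, Prod.fst_zero, Prod.snd_zero,
    Int.even_add, Int.even_mul, Int.even_pow, even_neg, Even.zero] at hev ⊢
  by_cases hx : Even x <;> by_cases hy : Even y <;> by_cases hz : Even z <;>
    by_cases hw : Even w <;> simp [hx, hy, hz, hw] at hev ⊢

theorem card_eisPairReps_filter_even (m : ℤ) :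
    ((eisPairReps (2 * (2 * m))).filter fun v => EisCongTwo v.1 0 ∧ EisCongTwo v.2 0).card =
      (eisPairReps m).card := by
  symm
  refine Finset.card_nbij' (fun v => ((2 * v.1.1, 2 * v.1.2), (2 * v.2.1, 2 * v.2.2)))
    (fun v => ((v.1.1 / 2, v.1.2 / 2), (v.2.1 / 2, v.2.2 / 2))) ?_ ?_ ?_ ?_
  · rintro ⟨⟨x, y⟩, ⟨z, w⟩⟩ h
    simp only [Finset.mem_coe, mem_eisPairReps, Finset.mem_filter] at h ⊢
    simp only [eisNorm, EisCongTwo] at h ⊢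
    refine ⟨by linarith, by simp⟩
  · rintro ⟨⟨x, y⟩, ⟨z, w⟩⟩ h
    simp only [Finset.mem_coe, mem_eisPairReps, Finset.mem_filter] at h ⊢
    simp only [eisNorm, EisCongTwo,
      Prod.fst_zero, Prod.snd_zero, add_zero] at h ⊢
    obtain ⟨h, ⟨⟨a, rfl⟩, ⟨b, rfl⟩⟩, ⟨c, rfl⟩, ⟨d, rfl⟩⟩ := h
    simp only [← two_mul, ne_eq, OfNat.ofNat_ne_zero, not_false_eq_true,
      Int.mul_ediv_cancel_left] at h ⊢
    linarith
  · rintro ⟨⟨x, y⟩, ⟨z, w⟩⟩ _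
    simp
  · rintro ⟨⟨x, y⟩, ⟨z, w⟩⟩ h
    simp only [Finset.mem_coe, Finset.mem_filter] at h
    simp only [EisCongTwo, Int.even_iff, Prod.fst_zero,
      Prod.snd_zero] at h
    simp only [Prod.mk.injEq]
    omega

theorem card_eisPairReps_four_mul (m : ℤ) :
    (eisPairReps (2 * (2 * m))).card + 2 * (eisPairReps m).card =
      3 * (eisPairReps (2 * m)).card := by
  rw [← card_eisPairReps_two_mul_add (2 * m), card_eisPairReps_filter_even]

theorem card_eisPairReps_two_mul_of_odd {m : ℤ} (hm : Odd m) :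
    (eisPairReps (2 * m)).card = 3 * (eisPairReps m).card := by
  rw [← card_eisPairReps_two_mul_add m, Finset.filter_false_of_mem, Finset.card_empty, mul_zero,
    add_zero]
  rintro ⟨⟨x, y⟩, ⟨z, w⟩⟩ h
  simp only [mem_eisPairReps, eisNorm, EisCongTwo, Prod.fst_zero, Prod.snd_zero, add_zero] at h ⊢
  rintro ⟨⟨⟨a, rfl⟩, ⟨b, rfl⟩⟩, ⟨c, rfl⟩, ⟨d, rfl⟩⟩
  obtain ⟨k, rfl⟩ := hm
  have : 2 * (a ^ 2 + a * b + b ^ 2 + c ^ 2 + c * d + d ^ 2) = 2 * k + 1 := by linarith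
  omega

theorem card_eisPairReps_two_pow_mul {m : ℤ} (hm : Odd m) (t : ℕ) :
    ((eisPairReps (2 ^ t * m)).card : ℤ) = (2 ^ (t + 1) - 1) * (eisPairReps m).card := by
  induction t using Nat.twoStepInduction with
  | zero => norm_num
  | one => simp [card_eisPairReps_two_mul_of_odd hm]
  | more t h0 h1 =>
    have h := card_eisPairReps_four_mul (2 ^ t * m)
    rw [show (2 : ℤ) ^ (t + 2) * m = 2 * (2 * (2 ^ t * m)) by ring]
    rw [show (2 : ℤ) ^ (t + 1) * m = 2 * (2 ^ t * m) by ring] at h1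
    zify at h
    rw [h1, h0] at h
    linear_combination h

/-- Multiplying both entries by a primitive cube root of unity is an action of order 3 whose only
fixed point, zero, is excluded. -/
theorem three_dvd_card_eisPairReps {m : ℤ} (hm : m ≠ 0) : 3 ∣ (eisPairReps m).card := by
  let e : ℤ × ℤ ≃ ℤ × ℤ := eisRot.trans eisRot
  have he : ∀ v, eisNorm (e v) = eisNorm v := by simp [e]
  have he3 : ∀ v, e (e (e v)) = v := by rintro ⟨x, y⟩; simp [e]
  have he1 : ∀ v, e v = v → v = 0 := by
    rintro ⟨x, y⟩ h
    simp only [e, Equiv.trans_apply, eisRot_apply, Prod.mk.injEq] at h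
    ext <;> simp <;> omega
  let f : Function.End (eisPairReps m) := fun v => ⟨(e v.1.1, e v.1.2), by
    have := v.2
    simp only [mem_eisPairReps, he] at this ⊢
    exact this⟩
  have : Fact (Nat.Prime 3) := ⟨Nat.prime_three⟩
  have hf : f ^ 3 ^ 1 = 1 := by
    funext v
    apply Subtype.ext
    change (e (e (e v.1.1)), e (e (e v.1.2))) = v.1
    simp [he3]
  have hmod := Equiv.Perm.card_fixedPoints_modEq hf
  rw [Fintype.card_coe, Fintype.card_eq_zero_iff.2] at hmod
  · exact (Nat.modEq_zero_iff_dvd).1 hmod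
  · refine ⟨fun v => hm ?_⟩
    have h := congrArg Subtype.val (show f v.1 = v.1 from v.2)
    have h1 := he1 _ (congrArg Prod.fst h)
    have h2 := he1 _ (congrArg Prod.snd h)
    have h3 := mem_eisPairReps.1 v.1.2
    rw [h1, h2] at h3
    simpa [eisNorm] using h3.symm

/-! ### Bead sets of Young diagrams and cores -/

namespace YoungDiagram

theorem lt_colLen_zero_iff {μ : YoungDiagram} {i : ℕ} : i < μ.colLen 0 ↔ 0 < μ.rowLen i := by
  rw [← mem_iff_lt_colLen, mem_iff_lt_rowLen]

theorem card_eq_sum_rowLen (μ : YoungDiagram) :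
    μ.card = ∑ i ∈ Finset.range (μ.colLen 0), μ.rowLen i := by
  rw [YoungDiagram.card, Finset.card_eq_sum_card_fiberwise (f := Prod.fst)
    (t := Finset.range (μ.colLen 0))]
  · exact Finset.sum_congr rfl fun i _ => (rowLen_eq_card μ).symm
  · rintro ⟨i, j⟩ h
    rw [Finset.mem_coe, mem_cells, mem_iff_lt_rowLen] at h
    exact Finset.mem_coe.2 (Finset.mem_range.2 (lt_colLen_zero_iff.2 (by simp only; omega)))

/-- The first column hook length of row `i` (meaningful for `i < μ.colLen 0`). -/
def bead (μ : YoungDiagram) (i : ℕ) : ℕ := μ.rowLen i + (μ.colLen 0 - 1 - i)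

/-- The set of first column hook lengths of a Young diagram. -/
def beads (μ : YoungDiagram) : Finset ℕ := (Finset.range (μ.colLen 0)).image μ.bead

theorem mem_beads {μ : YoungDiagram} {x : ℕ} : x ∈ μ.beads ↔ ∃ i < μ.colLen 0, μ.bead i = x := by
  simp [beads]

theorem bead_lt_bead {μ : YoungDiagram} {i l : ℕ} (h : i < l) (hl : l < μ.colLen 0) :
    μ.bead l < μ.bead i := by
  have := μ.rowLen_anti i l h.le
  unfold bead
  omega

theorem bead_injOn (μ : YoungDiagram) : Set.InjOn μ.bead (Finset.range (μ.colLen 0)) := by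
  intro a ha b hb hab
  rw [Finset.mem_coe, Finset.mem_range] at ha hb
  by_contra hne
  rcases lt_or_gt_of_ne hne with h | h
  · exact (bead_lt_bead h hb).ne' hab
  · exact (bead_lt_bead h ha).ne hab

theorem card_beads (μ : YoungDiagram) : μ.beads.card = μ.colLen 0 := by
  rw [beads, Finset.card_image_of_injOn μ.bead_injOn, Finset.card_range]

theorem zero_notMem_beads (μ : YoungDiagram) : 0 ∉ μ.beads := by
  rw [mem_beads]
  rintro ⟨i, hi, h⟩
  have := lt_colLen_zero_iff.1 hi
  unfold bead at h
  omega

theorem sum_beads (μ : YoungDiagram) :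
    ∑ x ∈ μ.beads, x = μ.card + ∑ i ∈ Finset.range μ.beads.card, i := by
  rw [card_beads, beads, Finset.sum_image μ.bead_injOn, card_eq_sum_rowLen]
  simp only [bead]
  rw [Finset.sum_add_distrib, Finset.sum_range_reflect (fun i => i)]

theorem beads_injective : Function.Injective beads := by
  intro μ ν h
  have hk : ν.colLen 0 = μ.colLen 0 := by rw [← card_beads, ← card_beads, h]
  have key : ∀ ξ : YoungDiagram, ξ.beads = μ.beads → ξ.colLen 0 = μ.colLen 0 →
      (fun i : Fin (μ.colLen 0) => ξ.bead (μ.colLen 0 - 1 - i)) =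
        μ.beads.orderEmbOfFin μ.card_beads := by
    intro ξ hξ hc
    apply Finset.orderEmbOfFin_unique
    · intro i
      rw [← hξ, mem_beads]
      exact ⟨_, by omega, rfl⟩
    · intro i l hil
      exact bead_lt_bead (by have := Fin.lt_def.1 hil; omega) (by omega)
  have hrow : ∀ i, μ.rowLen i = ν.rowLen i := by
    intro i
    by_cases hi : i < μ.colLen 0
    · have h2 := congrFun ((key μ rfl rfl).trans (key ν h.symm hk).symm)
        ⟨μ.colLen 0 - 1 - i, by omega⟩
      simp only [show μ.colLen 0 - 1 - (μ.colLen 0 - 1 - i) = i by omega, bead, hk] at h2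
      omega
    · have h1 := mt lt_colLen_zero_iff.2 hi
      have h2 := mt lt_colLen_zero_iff.2 (hk ▸ hi : ¬ i < ν.colLen 0)
      omega
  ext ⟨i, j⟩
  rw [mem_cells, mem_cells, mem_iff_lt_rowLen, mem_iff_lt_rowLen, hrow]

theorem exists_beads_eq (X : Finset ℕ) (h0 : 0 ∉ X) : ∃ μ : YoungDiagram, μ.beads = X := by
  set k := X.card with hk
  let g : ℕ → ℕ := fun i => if h : i < k then X.orderEmbOfFin rfl ⟨i, h⟩ else 0
  have hg : ∀ i, i < k → g i ∈ X := fun i hi => by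
    simp only [g, dif_pos hi]
    exact X.orderEmbOfFin_mem rfl _
  have hmono : ∀ i d, i + d < k → g i + d ≤ g (i + d) := by
    intro i d
    induction d with
    | zero => intro _; rfl
    | succ d ih =>
      intro h
      have h1 := ih (by omega)
      have h2 : g (i + d) < g (i + (d + 1)) := by
        simp only [g, dif_pos h, dif_pos (show i + d < k by omega)]
        exact (X.orderEmbOfFin rfl).strictMono (Fin.mk_lt_mk.2 (by omega))
      omega
  -- As 0 is not a bead, every row below is nonempty, so the diagram has exactly `k` rows.
  have hpos : ∀ i, i < k → i < g i := by
    intro i hi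
    have h1 := hmono 0 i (by omega)
    have h2 : g 0 ≠ 0 := fun h => h0 (h ▸ hg 0 (by omega))
    rw [Nat.zero_add] at h1
    omega
  -- Elements in decreasing order, minus the staircase.
  let w : List ℕ := List.ofFn fun i : Fin k => g (k - 1 - i) - (k - 1 - i)
  have hlen : w.length = k := by simp [w]
  have hget : ∀ (i : ℕ) (hi : i < w.length), w[i] = g (k - 1 - i) - (k - 1 - i) := by
    intro i hi
    simp [w]
  have hsort : w.SortedGE := by
    apply List.Pairwise.sortedGE
    rw [List.pairwise_iff_getElem]
    intro i l hi hl hil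
    rw [hget, hget]
    have := hmono (k - 1 - l) (l - i) (by omega)
    rw [show k - 1 - l + (l - i) = k - 1 - i by omega] at this
    omega
  have hwpos : ∀ x ∈ w, 0 < x := by
    intro x hx
    obtain ⟨i, hi, rfl⟩ := List.getElem_of_mem hx
    rw [hget]
    have := hpos (k - 1 - i) (by omega)
    omega
  refine ⟨ofRowLens w hsort, ?_⟩
  have hcol : (ofRowLens w hsort).colLen 0 = k := by
    rw [← length_rowLens, rowLens_length_ofRowLens hwpos, hlen]
  apply Finset.eq_of_subset_of_card_le
  · intro x hx
    obtain ⟨i, hi, rfl⟩ := mem_beads.1 hx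
    rw [hcol] at hi
    have h1 : (ofRowLens w hsort).rowLen i = _ := rowLen_ofRowLens ⟨i, by omega⟩
    have h2 := hpos (k - 1 - i) (by omega)
    simp only [Fin.getElem_fin, hget] at h1
    rw [bead, h1, hcol, Nat.sub_add_cancel h2.le]
    exact hg _ (by omega)
  · rw [card_beads, hcol]

/-- A Young diagram is a `t`-core if none of its hook numbers is a multiple of `t`. -/
def IsCore (t : ℕ) (μ : YoungDiagram) : Prop :=
  ∀ c ∈ μ.cells, ¬ t ∣ μ.hookNumber c.1 c.2

theorem hookNumber_le_bead {μ : YoungDiagram} {i j : ℕ} (h : (i, j) ∈ μ) :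
    μ.hookNumber i j ≤ μ.bead i := by
  have h1 := mem_iff_lt_rowLen.1 h
  have h2 := mem_iff_lt_colLen.1 h
  have h3 := μ.colLen_anti 0 j (Nat.zero_le _)
  unfold hookNumber bead
  omega

theorem bead_sub_hookNumber_notMem {μ : YoungDiagram} {i j : ℕ} (h : (i, j) ∈ μ) :
    μ.bead i - μ.hookNumber i j ∉ μ.beads := by
  have h1 := mem_iff_lt_rowLen.1 h
  have h2 := mem_iff_lt_colLen.1 h
  have h3 := μ.colLen_anti 0 j (Nat.zero_le _)
  rw [mem_beads]
  rintro ⟨l, hl, h4⟩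
  have h5 : j < μ.rowLen l ↔ l < μ.colLen j := by rw [← mem_iff_lt_rowLen, mem_iff_lt_colLen]
  unfold hookNumber bead at h4
  omega

/-- Columns correspond to gaps in the bead set: the column sought is numbered by the gaps below `v`,
and its length is the number of beads above `v`. -/
theorem exists_hookNumber_eq {μ : YoungDiagram} {i v : ℕ} (hi : i < μ.colLen 0)
    (hv : v < μ.bead i) (hvX : v ∉ μ.beads) :
    ∃ j, (i, j) ∈ μ ∧ μ.hookNumber i j = μ.bead i - v := by
  have hex : ∃ c, μ.colLen 0 ≤ c ∨ μ.bead c < v := ⟨_, Or.inl le_rfl⟩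
  -- `c` is the number of beads above `v`.
  obtain ⟨c, hc, hmin⟩ : ∃ c, (μ.colLen 0 ≤ c ∨ μ.bead c < v) ∧
      ∀ l < c, l < μ.colLen 0 ∧ v < μ.bead l := by
    refine ⟨Nat.find hex, Nat.find_spec hex, fun l hl => ?_⟩
    have h := Nat.find_min hex hl
    push Not at h
    exact ⟨h.1, lt_of_le_of_ne h.2 fun he => hvX (mem_beads.2 ⟨l, h.1, he.symm⟩)⟩
  have hic : i < c := by
    by_contra hci
    rcases hc with hc | hc
    · omega
    · rcases Nat.lt_or_eq_of_le (not_lt.1 hci) with h | h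
      · have := bead_lt_bead h hi; omega
      · subst h; omega
  have hck : c ≤ μ.colLen 0 := by
    have := (hmin (c - 1) (by omega)).1
    omega
  have hlast := (hmin (c - 1) (by omega)).2
  have hzero := lt_colLen_zero_iff (μ := μ) (i := c)
  have hkv : μ.colLen 0 ≤ v + c := by
    unfold bead at hc
    omega
  have hcol : μ.colLen (v + c - μ.colLen 0) = c := by
    apply le_antisymm
    · rw [← not_lt, ← mem_iff_lt_colLen, mem_iff_lt_rowLen]
      unfold bead at hc
      omega
    · have : c - 1 < μ.colLen (v + c - μ.colLen 0) := by
        rw [← mem_iff_lt_colLen, mem_iff_lt_rowLen]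
        unfold bead at hlast
        omega
      omega
  have hmem : (i, v + c - μ.colLen 0) ∈ μ := by rw [mem_iff_lt_colLen, hcol]; exact hic
  refine ⟨_, hmem, ?_⟩
  have := mem_iff_lt_rowLen.1 hmem
  unfold hookNumber bead
  rw [hcol]
  omega

/-- Hook numbers are the differences between a bead and a smaller gap; closure under one step of `t`
excludes all multiples of `t`. -/
theorem isCore_iff {t : ℕ} (ht : 0 < t) {μ : YoungDiagram} :
    μ.IsCore t ↔ ∀ x, x + t ∈ μ.beads → x ∈ μ.beads := by
  constructor
  · intro h x hx
    by_contra hx'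
    obtain ⟨i, hi, hb⟩ := mem_beads.1 hx
    obtain ⟨j, hj, hh⟩ := exists_hookNumber_eq hi (by omega) hx'
    exact h (i, j) ((mem_cells _).2 hj) ⟨1, by simp only; omega⟩
  · rintro h ⟨i, j⟩ hc ⟨s, hs⟩
    rw [mem_cells] at hc
    have hmul : ∀ s x, x + t * s ∈ μ.beads → x ∈ μ.beads := by
      intro s
      induction s with
      | zero => intro x hx; exact hx
      | succ s ih => exact fun x hx => ih x (h _ (by rwa [add_assoc, ← Nat.mul_succ]))
    refine bead_sub_hookNumber_notMem hc (hmul s _ ?_)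
    have hle := hookNumber_le_bead hc
    simp only at hs
    rw [← hs, Nat.sub_add_cancel hle, mem_beads]
    refine ⟨i, lt_of_lt_of_le (mem_iff_lt_colLen.1 hc) (μ.colLen_anti 0 j (Nat.zero_le _)), rfl⟩

end YoungDiagram

/-! ### The 3-core bead sets -/

/-- The bead set `{1, 4, …, 3a - 2} ∪ {2, 5, …, 3b - 1}`. -/
def threeCoreBeads (a b : ℕ) : Finset ℕ :=
  (Finset.range a).image (fun i => 3 * i + 1) ∪ (Finset.range b).image fun i => 3 * i + 2

theorem mem_threeCoreBeads {a b x : ℕ} : x ∈ threeCoreBeads a b ↔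
    (x % 3 = 1 ∧ x < 3 * a) ∨ (x % 3 = 2 ∧ x < 3 * b) := by
  simp only [threeCoreBeads, Finset.mem_union, Finset.mem_image, Finset.mem_range]
  constructor
  · rintro (⟨i, hi, rfl⟩ | ⟨i, hi, rfl⟩) <;> omega
  · rintro (h | h)
    · exact Or.inl ⟨x / 3, by omega, by omega⟩
    · exact Or.inr ⟨x / 3, by omega, by omega⟩

theorem disjoint_threeCoreBeads (a b : ℕ) :
    Disjoint ((Finset.range a).image fun i => 3 * i + 1)
      ((Finset.range b).image fun i => 3 * i + 2) := by
  rw [Finset.disjoint_left]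
  simp only [Finset.mem_image]
  rintro x ⟨i, -, rfl⟩ ⟨l, -, h⟩
  omega

theorem card_threeCoreBeads (a b : ℕ) : (threeCoreBeads a b).card = a + b := by
  rw [threeCoreBeads, Finset.card_union_of_disjoint (disjoint_threeCoreBeads a b),
    Finset.card_image_of_injective _ fun x y h => by simpa using h,
    Finset.card_image_of_injective _ fun x y h => by simpa using h, Finset.card_range,
    Finset.card_range]

theorem sum_threeCoreBeads (a b : ℕ) :
    ∑ x ∈ threeCoreBeads a b, x + a * b = ∑ i ∈ Finset.range (a + b), i + (a ^ 2 + b ^ 2 + b) := by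
  rw [threeCoreBeads, Finset.sum_union (disjoint_threeCoreBeads a b),
    Finset.sum_image fun x _ y _ h => by simpa using h,
    Finset.sum_image fun x _ y _ h => by simpa using h]
  have h1 : ∀ n : ℕ, (∑ i ∈ Finset.range n, i) * 2 + n = n * n := by
    intro n
    induction n with
    | zero => rfl
    | succ n ih => rw [Finset.sum_range_succ]; linarith
  rw [Finset.sum_add_distrib, Finset.sum_add_distrib, ← Finset.mul_sum, ← Finset.mul_sum]
  simp only [Finset.sum_const, Finset.card_range, smul_eq_mul, mul_one]
  nlinarith [h1 a, h1 b, h1 (a + b)]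

/-- `X` meets each residue class mod 3 in an initial segment, and the class of 0 is empty. -/
theorem exists_eq_threeCoreBeads {X : Finset ℕ} (h0 : 0 ∉ X) (h : ∀ x, x + 3 ∈ X → x ∈ X) :
    ∃ a b, X = threeCoreBeads a b := by
  have key : ∀ r, ∃ a, ∀ i, 3 * i + r ∈ X ↔ i < a := by
    intro r
    have hex : ∃ a, 3 * a + r ∉ X := by
      obtain ⟨B, hB⟩ := X.bddAbove
      exact ⟨B + 1, fun hm => by have := hB hm; omega⟩
    refine ⟨Nat.find hex, fun i => ⟨fun hi => ?_, fun hi => not_not.1 (Nat.find_min hex hi)⟩⟩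
    by_contra hlt
    have hdown : ∀ d x, x + 3 * d ∈ X → x ∈ X := by
      intro d
      induction d with
      | zero => exact fun x hx => hx
      | succ d ih => exact fun x hx => ih x (h _ (by rwa [add_assoc]))
    exact Nat.find_spec hex (hdown (i - Nat.find hex) _ (by
      rwa [show 3 * Nat.find hex + r + 3 * (i - Nat.find hex) = 3 * i + r by omega]))
  obtain ⟨z, hz⟩ := key 0
  obtain ⟨a, ha⟩ := key 1
  obtain ⟨b, hb⟩ := key 2
  refine ⟨a, b, ?_⟩
  ext x
  rw [mem_threeCoreBeads]
  have hz0 : ¬ 0 < z := fun h' => h0 ((hz 0).2 h')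
  have hx := Nat.div_add_mod x 3
  have : x % 3 = 0 ∨ x % 3 = 1 ∨ x % 3 = 2 := by omega
  rcases this with h3 | h3 | h3 <;> rw [h3] at hx
  · rw [← hx, hz]; omega
  · rw [← hx, ha]; omega
  · rw [← hx, hb]; omega

theorem threeCoreBeads_inj {a b a' b' : ℕ} (h : threeCoreBeads a b = threeCoreBeads a' b') :
    a = a' ∧ b = b' := by
  have key : ∀ x, x ∈ threeCoreBeads a b ↔ x ∈ threeCoreBeads a' b' := by simp [h]
  simp only [mem_threeCoreBeads] at key
  have h1 := key (3 * a + 1)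
  have h2 := key (3 * a' + 1)
  have h3 := key (3 * b + 2)
  have h4 := key (3 * b' + 2)
  omega

theorem YoungDiagram.sum_rowLens (μ : YoungDiagram) : μ.rowLens.sum = μ.card :=
  μ.card_eq_sum_rowLen.symm

/-! ### Partitions as Young diagrams -/

namespace Nat.Partition

theorem rowLens_youngDiagram {n : ℕ} (l : n.Partition) :
    l.youngDiagram.rowLens = l.parts.sort (· ≥ ·) :=
  YoungDiagram.rowLens_ofRowLens_eq_self fun _ hx => l.parts_pos ((Multiset.mem_sort _).1 hx)

theorem youngDiagram_injective {n : ℕ} :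
    Function.Injective (youngDiagram : n.Partition → YoungDiagram) := by
  intro l l' h
  have h1 := l.rowLens_youngDiagram
  rw [h, l'.rowLens_youngDiagram] at h1
  apply Nat.Partition.ext
  rw [← Multiset.sort_eq l.parts (· ≥ ·), ← h1, Multiset.sort_eq]

theorem card_youngDiagram {n : ℕ} (l : n.Partition) : l.youngDiagram.card = n := by
  have h : l.youngDiagram.rowLens.sum = n := by
    rw [l.rowLens_youngDiagram, ← Multiset.sum_coe, Multiset.sort_eq, l.parts_sum]
  rwa [YoungDiagram.sum_rowLens] at h

theorem exists_youngDiagram_eq (μ : YoungDiagram) :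
    ∃ l : μ.card.Partition, l.youngDiagram = μ := by
  refine ⟨⟨μ.rowLens, fun {i} hi => μ.pos_of_mem_rowLens i (Multiset.mem_coe.1 hi), ?_⟩, ?_⟩
  · rw [Multiset.sum_coe, YoungDiagram.sum_rowLens]
  · have h : (μ.rowLens : Multiset ℕ).sort (· ≥ ·) = μ.rowLens :=
      List.Perm.eq_of_pairwise' (Multiset.pairwise_sort _ _) μ.rowLens_sorted.pairwise
        (Multiset.coe_eq_coe.1 (Multiset.sort_eq _ _))
    unfold youngDiagram
    simp only [h]
    exact YoungDiagram.ofRowLens_to_rowLens_eq_self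

end Nat.Partition

/-! ### From 3-cores to Eisenstein integers -/

/-- A fundamental domain for the units acting on Eisenstein integers of norm prime to `3`. -/
def EisPrimary (v : ℤ × ℤ) : Prop :=
  0 < v.1 + 2 * v.2 ∧ 0 < 2 * v.1 + v.2 ∧ (v.1 - v.2) % 3 = 1

instance : DecidablePred EisPrimary := fun v => by unfold EisPrimary; infer_instance

theorem eisNorm_emod_three (v : ℤ × ℤ) :
    ((v.1 - v.2) % 3 = 0 ∧ eisNorm v % 3 = 0) ∨ ((v.1 - v.2) % 3 ≠ 0 ∧ eisNorm v % 3 = 1) := by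
  have h : eisNorm v = (v.1 - v.2) ^ 2 + 3 * (v.1 * v.2) := by unfold eisNorm; ring
  rw [h, Int.add_mul_emod_self_left, pow_two, Int.mul_emod]
  have : (v.1 - v.2) % 3 = 0 ∨ (v.1 - v.2) % 3 = 1 ∨ (v.1 - v.2) % 3 = 2 := by omega
  rcases this with h3 | h3 | h3 <;> rw [h3] <;> simp

/-- The two inequalities cut out a sector of 120°, which holds two consecutive rotations. Each
rotation by 60° negates `x - y` mod 3, so exactly one of the two has residue 1. The hypothesis keeps
points off the boundary. -/
theorem sum_primary_rot {x y : ℤ} (h : (x - y) % 3 ≠ 0) :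
    ∑ k ∈ Finset.range 6, (if EisPrimary ((eisRot ^ k : Equiv.Perm (ℤ × ℤ)) (x, y))
      then 1 else 0) = 1 := by
  have e0 : EisPrimary (x, y) ↔ 0 < x + 2 * y ∧ 0 < 2 * x + y ∧ (x - y) % 3 = 1 := Iff.rfl
  have e1 : EisPrimary (-y, x + y) ↔ 0 < 2 * x + y ∧ 0 < x - y ∧ ¬ (x - y) % 3 = 1 := by
    simp only [EisPrimary]; omega
  have e2 : EisPrimary (-(x + y), -y + (x + y)) ↔
      0 < x - y ∧ ¬ 0 < x + 2 * y ∧ (x - y) % 3 = 1 := by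
    simp only [EisPrimary]; omega
  have e3 : EisPrimary (-(-y + (x + y)), -(x + y) + (-y + (x + y))) ↔
      ¬ 0 < x + 2 * y ∧ ¬ 0 < 2 * x + y ∧ ¬ (x - y) % 3 = 1 := by
    simp only [EisPrimary]; omega
  have e4 : EisPrimary (-(-(x + y) + (-y + (x + y))),
      -(-y + (x + y)) + (-(x + y) + (-y + (x + y)))) ↔
      ¬ 0 < 2 * x + y ∧ ¬ 0 < x - y ∧ (x - y) % 3 = 1 := by
    simp only [EisPrimary]; omega
  have e5 : EisPrimary (-(-(-y + (x + y)) + (-(x + y) + (-y + (x + y)))),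
      -(-(x + y) + (-y + (x + y))) + (-(-y + (x + y)) + (-(x + y) + (-y + (x + y))))) ↔
      ¬ 0 < x - y ∧ 0 < x + 2 * y ∧ ¬ (x - y) % 3 = 1 := by
    simp only [EisPrimary]; omega
  have h1 : 0 < x + 2 * y → 0 < x - y → 0 < 2 * x + y := by omega
  have h2 : ¬ 0 < x + 2 * y → ¬ 0 < x - y → ¬ 0 < 2 * x + y := by omega
  simp only [Finset.sum_range_succ, Finset.sum_range_zero, pow_succ, pow_zero,
    Equiv.Perm.mul_apply, Equiv.Perm.one_apply, eisRot_apply, e0, e1, e2, e3, e4, e5]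
  by_cases hP : 0 < x + 2 * y <;> by_cases hD : 0 < x - y <;> by_cases hQ : 0 < 2 * x + y <;>
    by_cases hR : (x - y) % 3 = 1 <;>
    first
    | exact absurd (h1 hP hD) hQ
    | exact absurd hQ (h2 hP hD)
    | simp only [hP, hD, hQ, hR, not_true_eq_false, not_false_eq_true, and_true,
        and_false, if_true, if_false, add_zero, zero_add]

theorem card_eisReps (n : ℕ) :
    (eisReps (3 * n + 1)).card = 6 * ((eisReps (3 * n + 1)).filter EisPrimary).card := by
  have hrot : ∀ (k : ℕ) (v : ℤ × ℤ),
      eisNorm ((eisRot ^ k : Equiv.Perm (ℤ × ℤ)) v) = eisNorm v := by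
    intro k
    induction k with
    | zero => intro v; rfl
    | succ k ih => intro v; rw [pow_succ, Equiv.Perm.mul_apply, ih, eisNorm_eisRot]
  have h1 : ∀ k ∈ Finset.range 6, ∑ v ∈ eisReps (3 * n + 1),
      (if EisPrimary ((eisRot ^ k : Equiv.Perm (ℤ × ℤ)) v) then 1 else 0) =
        ((eisReps (3 * n + 1)).filter EisPrimary).card := by
    intro k _
    rw [Finset.card_filter]
    exact Finset.sum_equiv (eisRot ^ k : Equiv.Perm (ℤ × ℤ)) (by simp [hrot]) (by simp)
  have h2 := Finset.sum_congr rfl h1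
  rw [Finset.sum_const, Finset.card_range, smul_eq_mul, Finset.sum_comm] at h2
  rw [← h2, Finset.card_eq_sum_ones]
  refine Finset.sum_congr rfl fun v hv => (sum_primary_rot ?_).symm
  have := eisNorm_emod_three v
  rw [mem_eisReps.1 hv] at this
  omega

theorem exists_beads_eq_threeCoreBeads {n : ℕ} {l : n.Partition} (hl : l ∈ corePartitions 3 n) :
    ∃ v : ℕ × ℕ, l.youngDiagram.beads = threeCoreBeads v.1 v.2 ∧
      n + v.1 * v.2 = v.1 ^ 2 + v.2 ^ 2 + v.2 := by
  have hcore : l.youngDiagram.IsCore 3 := (Finset.mem_filter.1 hl).2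
  obtain ⟨a, b, h⟩ := exists_eq_threeCoreBeads l.youngDiagram.zero_notMem_beads
    ((YoungDiagram.isCore_iff (by norm_num)).1 hcore)
  refine ⟨(a, b), h, ?_⟩
  have h1 := l.youngDiagram.sum_beads
  have h2 := sum_threeCoreBeads a b
  rw [h, card_threeCoreBeads, l.card_youngDiagram] at h1
  simp only
  omega

theorem exists_corePartition {n a b : ℕ} (h : n + a * b = a ^ 2 + b ^ 2 + b) :
    ∃ l ∈ corePartitions 3 n, l.youngDiagram.beads = threeCoreBeads a b := by
  obtain ⟨μ, hμ⟩ := YoungDiagram.exists_beads_eq (threeCoreBeads a b)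
    (by simp [mem_threeCoreBeads])
  have h1 := μ.sum_beads
  have h2 := sum_threeCoreBeads a b
  rw [hμ, card_threeCoreBeads] at h1
  obtain rfl : n = μ.card := by omega
  obtain ⟨l, hl⟩ := Nat.Partition.exists_youngDiagram_eq μ
  refine ⟨l, Finset.mem_filter.2 ⟨Finset.mem_univ _, ?_⟩, by rw [hl, hμ]⟩
  change l.youngDiagram.IsCore 3
  rw [hl, YoungDiagram.isCore_iff (by norm_num), hμ]
  simp only [mem_threeCoreBeads]
  omega

theorem card_corePartitions_three (n : ℕ) :
    (corePartitions 3 n).card = ((eisReps (3 * n + 1)).filter EisPrimary).card := by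
  choose f hf hn using fun l hl => exists_beads_eq_threeCoreBeads (n := n) (l := l) hl
  refine Finset.card_bij (fun l hl =>
    -- Solves `x + 2y = 3a + 1`, `2x + y = 3b + 2`; primary means precisely that `a` and `b` are
    -- natural numbers.
    ((2 * (f l hl).2 - (f l hl).1 + 1 : ℤ), (2 * (f l hl).1 - (f l hl).2 : ℤ))) ?_ ?_ ?_
  · intro l hl
    have h := hn l hl
    zify at h
    rw [Finset.mem_filter, mem_eisReps]
    refine ⟨?_, ?_⟩
    · unfold eisNorm
      linear_combination (-3) * h
    · unfold EisPrimary
      simp only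
      omega
  · intro l hl l' hl' h
    simp only [Prod.mk.injEq] at h
    apply Nat.Partition.youngDiagram_injective
    apply YoungDiagram.beads_injective
    rw [hf l hl, hf l' hl', show (f l hl).1 = (f l' hl').1 by omega,
      show (f l hl).2 = (f l' hl').2 by omega]
  · rintro ⟨x, y⟩ h
    rw [Finset.mem_filter, mem_eisReps] at h
    obtain ⟨h1, h2, h3, h4⟩ := h
    simp only at h2 h3 h4
    obtain ⟨a, ha⟩ : ∃ a : ℕ, x + 2 * y = 3 * a + 1 := ⟨((x + 2 * y) / 3).toNat, by omega⟩
    obtain ⟨b, hb⟩ : ∃ b : ℕ, 2 * x + y = 3 * b + 2 := ⟨((2 * x + y) / 3).toNat, by omega⟩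
    obtain rfl : x = 2 * b - a + 1 := by omega
    obtain rfl : y = 2 * a - b := by omega
    obtain ⟨l, hl, hb⟩ := exists_corePartition (n := n) (a := a) (b := b) (by
      zify
      unfold eisNorm at h1
      simp only at h1
      linarith)
    refine ⟨l, hl, ?_⟩
    obtain ⟨e1, e2⟩ := threeCoreBeads_inj ((hf l hl).symm.trans hb)
    rw [e1, e2]

theorem card_eisPairReps (n : ℕ) : (eisPairReps (3 * n + 2)).card = 36 * A₃ n := by
  have hA : A₃ n = ∑ s ∈ Finset.HasAntidiagonal.antidiagonal n,
      (corePartitions 3 s.1).card * (corePartitions 3 s.2).card := by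
    rw [A₃, corePartitionPairs, Finset.card_sigma]
    simp only [Finset.card_product]
  rw [hA, Finset.mul_sum, Finset.card_eq_sum_card_fiberwise
    (f := fun v => (((eisNorm v.1) / 3).toNat, ((eisNorm v.2) / 3).toNat))
    (t := Finset.HasAntidiagonal.antidiagonal n)]
  · refine Finset.sum_congr rfl fun s hs => ?_
    rw [Finset.HasAntidiagonal.mem_antidiagonal] at hs
    rw [card_corePartitions_three, card_corePartitions_three,
      show ∀ u v : ℕ, 36 * (u * v) = (6 * u) * (6 * v) by intros; ring, ← card_eisReps,
      ← card_eisReps, ← Finset.card_product]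
    congr 1
    ext v
    have h1 := eisNorm_emod_three v.1
    have h2 := eisNorm_emod_three v.2
    have h3 := eisNorm_nonneg v.1
    have h4 := eisNorm_nonneg v.2
    simp only [Finset.mem_filter, mem_eisPairReps, Finset.mem_product, mem_eisReps, Prod.ext_iff]
    omega
  · intro v hv
    rw [Finset.mem_coe, mem_eisPairReps] at hv
    have h1 := eisNorm_emod_three v.1
    have h2 := eisNorm_emod_three v.2
    have h3 := eisNorm_nonneg v.1
    have h4 := eisNorm_nonneg v.2
    rw [Finset.mem_coe, Finset.HasAntidiagonal.mem_antidiagonal]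
    simp only
    omega

/-! ### The congruence -/

theorem mainTheorem3 (p j : ℕ) (hp : p.Prime) (hp2 : p ≠ 2) (hj : 1 ≤ j) :
    ∃ k₀ : ℕ, 0 < k₀ ∧ 2 * k₀ = p ^ j * (p - 1) ∧
      ∀ n α : ℕ,
        3 ∣ 2 ^ (2 * k₀ * (α + 1) - 1) - 2 ∧
        A₃ (4 ^ (k₀ * (α + 1)) * n + (2 ^ (2 * k₀ * (α + 1) - 1) - 2) / 3) ≡ 0 [MOD p ^ j] := by
  obtain ⟨q, hq⟩ := hp.even_sub_one hp2
  have hp3 : 3 ≤ p := by have := hp.two_le; omega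
  have hpos : 0 < p ^ j := pow_pos hp.pos j
  refine ⟨p ^ j * q, Nat.mul_pos hpos (by omega), by rw [hq]; ring, fun n α => ?_⟩
  obtain ⟨K, hK⟩ : ∃ K, p ^ j * q * (α + 1) = K + 1 :=
    Nat.exists_eq_succ_of_ne_zero (by positivity [show 0 < q by omega])
  rw [mul_assoc 2, hK, show 2 * (K + 1) - 1 = 2 * K + 1 by omega]
  obtain ⟨c, hc⟩ : ∃ c, 4 ^ K = 3 * c + 1 := by
    have : 4 ^ K % 3 = 1 := by rw [Nat.pow_mod]; simp
    exact ⟨4 ^ K / 3, by omega⟩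
  have h2K : 2 ^ (2 * K + 1) = 6 * c + 2 := by
    rw [pow_succ, pow_mul, show 2 ^ 2 = 4 by rfl, hc]; ring
  rw [h2K, show 6 * c + 2 - 2 = 3 * (2 * c) by omega]
  refine ⟨dvd_mul_right _ _, ?_⟩
  rw [Nat.mul_div_cancel_left _ (by norm_num), Nat.modEq_zero_iff_dvd, pow_succ, hc]
  set N := (3 * c + 1) * 4 * n + 2 * c with hN
  have hR := card_eisPairReps N
  have hodd : Odd (6 * (n : ℤ) + 1) := ⟨3 * n, by ring⟩
  have hpow := card_eisPairReps_two_pow_mul hodd (2 * K + 1)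
  have hNval : (2 : ℤ) ^ (2 * K + 1) * (6 * n + 1) = 3 * N + 2 := by
    have : (2 : ℤ) ^ (2 * K + 1) = 6 * c + 2 := by exact_mod_cast h2K
    rw [this, hN]
    push_cast
    ring
  obtain ⟨r, hr⟩ := three_dvd_card_eisPairReps (m := 6 * (n : ℤ) + 1) (by omega)
  rw [hNval, hR, hr] at hpow
  -- `2K + 2 = φ(p^(j+1)) (α + 1)`.
  have hdvd : p ^ (j + 1) ∣ 2 ^ (2 * K + 2) - 1 := by
    have hcop : Nat.Coprime 2 (p ^ (j + 1)) :=
      Nat.Coprime.pow_right _ ((Nat.coprime_primes Nat.prime_two hp).2 (Ne.symm hp2))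
    have h := (Nat.ModEq.pow_totient hcop).pow (α + 1)
    rw [Nat.totient_prime_pow_succ hp, hq, ← pow_mul,
      show p ^ j * (q + q) * (α + 1) = 2 * (p ^ j * q * (α + 1)) by ring, hK, one_pow] at h
    exact (Nat.modEq_iff_dvd' Nat.one_le_two_pow).1 h.symm
  have h12 : 12 * A₃ N = (2 ^ (2 * K + 2) - 1) * r := by
    zify [Nat.one_le_two_pow (n := 2 * K + 2)]
    push_cast at hpow
    linarith
  have hd : p ^ (j + 1) ∣ 4 * (3 * A₃ N) := by
    rw [show 4 * (3 * A₃ N) = 12 * A₃ N by ring, h12]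
    exact hdvd.mul_right r
  have hd4 : p ^ (j + 1) ∣ 3 * A₃ N := by
    refine Nat.Coprime.dvd_of_dvd_mul_left ?_ hd
    rw [show 4 = 2 ^ 2 by rfl]
    exact Nat.Coprime.pow _ _ ((Nat.coprime_primes hp Nat.prime_two).2 hp2)
  -- For `p = 3` the remaining factor 3 uses up the spare power.
  by_cases h3 : p = 3
  · subst h3
    rw [pow_succ'] at hd4
    exact Nat.dvd_of_mul_dvd_mul_left (by norm_num) hd4
  · exact Nat.Coprime.dvd_of_dvd_mul_left
      (Nat.Coprime.pow_left _ ((Nat.coprime_primes hp Nat.prime_three).2 h3))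
      ((pow_dvd_pow p (Nat.le_succ j)).trans hd4)
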